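/- **Theorem 3.1.** Let $n$ be a natural number and $[n]=\{1,\dots,n\}$. *Convex rank tests.* A fan in $\mathbb{R}^n$ is a finite collection $\mathcal{F}$ of polyhedral cones such that every face of a cone in $\mathcal{F}$ is in $\mathcal{F}$, and $C\cap C'$ is a face of $C$ for all $C,C'\in\mathcal{F}$. (Faces are the nonempty faces, which all contain $0$.) Two vectors $u,v\in\mathbb{R}^n$ are permutation equivalent if, for all $i,j\in[n]$, $u_i<u_j$ if and only if $v_i<v_j$, and $u_i=u_j$ if and only if $v_i=v_j$. A coarsening of the $S_n$-fan (the fan of the braid arrangement) is a fan $\mathcal{F}$ in $\mathbb{R}^n$ such that each permutation equivalence class is contained in some cone of $\mathcal{F}$. We write a permutation of $[n]$ as its descent vector $\delta=(\delta_1|\delta_2|\cdots|\delta_n)$; it indexes the maximal cone $\{u\in\mathbb{R}^n : u_{\delta_1}\ge u_{\delta_2}\ge\cdots\ge u_{\delta_n}\}$ of the $S_n$-fan. A coarsening $\mathcal{F}$ induces a partition of $S_n$: two permutations are in the same class if and only if their maximal cones are contained in a common cone of $\mathcal{F}$. A convex rank test is a partition of $S_n$ that is induced in this way by some coarsening of the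 $S_n$-fan. *Semigraphoids.* Let $\mathcal{T}_n$ be the set of all elementary conditional independence (CI) statements $i\perp\!\!\!\perp j\,|\,K$ with $i\neq j$ in $[n]$ and $K\subseteq[n]\setminus\{i,j\}$. A subset $\mathcal{M}\subseteq\mathcal{T}_n$ is a semigraphoid if $i\perp\!\!\!\perp j\,|\,K\in\mathcal{M}$ implies $j\perp\!\!\!\perp i\,|\,K\in\mathcal{M}$, and, for all distinct $i,j,\ell$ and all $K\subseteq[n]\setminus\{i,j,\ell\}$, $$i\perp\!\!\!\perp j\,|\,K\cup\{\ell\}\in\mathcal{M}\ \text{ and }\ i\perp\!\!\!\perp \ell\,|\,K\in\mathcal{M}\quad\Longrightarrow\quad i\perp\!\!\!\perp j\,|\,K\in\mathcal{M}\ \text{ and }\ i\perp\!\!\!\perp \ell\,|\,K\cup\{j\}\in\mathcal{M}.$$ *The map.* Two permutations $\delta,\delta'$ share a wall at $k$ if $\delta'$ arises from $\delta$ by exchanging the entries $\delta_k$ and $\delta_{k+1}$; this wall is labelled by the CI statement $\delta_k\perp\!\!\!\perp\delta_{k+1}\,|\,\{\delta_1,\dots,\delta_{k-1}\}$ and by its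 mirror image $\delta_{k+1}\perp\!\!\!\perp\delta_k\,|\,\{\delta_1,\dots,\delta_{k-1}\}$. For a convex rank test $\mathcal{F}$, let $\mathcal{M}_{\mathcal{F}}\subseteq\mathcal{T}_n$ be the set of labels of the removed walls, i.e. of those walls whose two permutations $\delta,\delta'$ lie in the same class of $\mathcal{F}$. Then the map $\mathcal{F}\mapsto\mathcal{M}_{\mathcal{F}}$ is a bijection from the set of convex rank tests on $S_n$ to the set of semigraphoids $\mathcal{M}\subseteq\mathcal{T}_n$. -/

import Mathlib

/-! ### Polyhedral cones and fans in `ℝⁿ` -/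

/-- A polyhedral cone in `ℝⁿ`: the intersection of finitely many closed half-spaces `{u | 0 ≤ f u}`
given by linear functionals `f`. -/
def IsPolyhedralCone {n : ℕ} (C : PointedCone ℝ (Fin n → ℝ)) : Prop :=
  PointedCone.DualFG
    (LinearMap.id : Module.Dual ℝ (Fin n → ℝ) →ₗ[ℝ] Module.Dual ℝ (Fin n → ℝ)) C

/-- A fan in `ℝⁿ`: a finite collection of polyhedral cones that contains every face of each of its
members, and in which any two members meet in a common face. (For polyhedral cones, the faces in
the sense of `PointedCone.IsFaceOf` are exactly the subsets of the cone where some linear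
functional attains its minimum over the cone.) -/
structure IsFan {n : ℕ} (F : Set (PointedCone ℝ (Fin n → ℝ))) : Prop where
  finite : F.Finite
  polyhedral : ∀ C ∈ F, IsPolyhedralCone C
  face_mem : ∀ C ∈ F, ∀ D : PointedCone ℝ (Fin n → ℝ), D.IsFaceOf C → D ∈ F
  inter_face : ∀ C ∈ F, ∀ D ∈ F, (C ⊓ D).IsFaceOf C

/-! ### The `S_n`-fan and its coarsenings -/

/-- Permutation equivalence of vectors: the coordinates compare in the same way. -/
def PermEquivalent {n : ℕ} (u v : Fin n → ℝ) : Prop :=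
  ∀ i j, (u i < u j ↔ v i < v j) ∧ (u i = u j ↔ v i = v j)

/-- The maximal cone of the `S_n`-fan indexed by the permutation with descent vector
`δ = (δ 0 | δ 1 | ... | δ (n-1))`: the vectors `u` with `u (δ 0) ≥ u (δ 1) ≥ ... ≥ u (δ (n-1))`. -/
def weylChamber {n : ℕ} (δ : Equiv.Perm (Fin n)) : Set (Fin n → ℝ) :=
  {u | Antitone (fun k => u (δ k))}

/-- A coarsening of the `S_n`-fan: a fan such that each permutation equivalence class of `ℝⁿ` is
contained in some cone of the fan. -/
structure IsCoarsening {n : ℕ} (F : Set (PointedCone ℝ (Fin n → ℝ))) : Prop extends IsFan F where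
  exists_cone : ∀ u : Fin n → ℝ, ∃ C ∈ F, {v | PermEquivalent u v} ⊆ (C : Set (Fin n → ℝ))

/-- A vector with descent vector `δ`, in the interior of the chamber. -/
def chamberPoint {n : ℕ} (δ : Equiv.Perm (Fin n)) : Fin n → ℝ :=
  fun i => -((δ.symm i : ℕ) : ℝ)

theorem permEquivalent_chamberPoint {n : ℕ} {δ : Equiv.Perm (Fin n)} {v : Fin n → ℝ}
    (hv : StrictAnti (fun k => v (δ k))) : PermEquivalent (chamberPoint δ) v := by
  intro i j
  obtain ⟨a, rfl⟩ := δ.surjective i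
  obtain ⟨b, rfl⟩ := δ.surjective j
  have h1 : v (δ a) < v (δ b) ↔ b < a := hv.lt_iff_gt
  have h2 : v (δ a) = v (δ b) ↔ a = b := hv.injective.eq_iff
  rw [h1, h2]
  constructor
  · simp [chamberPoint]
  · simp [chamberPoint, Fin.ext_iff]

/-- Each maximal cone of the `S_n`-fan is contained in some cone of a coarsening. -/
theorem IsCoarsening.exists_weylChamber_subset {n : ℕ} {F : Set (PointedCone ℝ (Fin n → ℝ))}
    (hF : IsCoarsening F) (δ : Equiv.Perm (Fin n)) :
    ∃ C ∈ F, weylChamber δ ⊆ (C : Set (Fin n → ℝ)) := by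
  obtain ⟨C, hC, hsub⟩ := hF.exists_cone (chamberPoint δ)
  refine ⟨C, hC, fun u hu => ?_⟩
  obtain ⟨s, rfl⟩ := hF.polyhedral C hC
  change u ∈ PointedCone.dual _ _
  rw [PointedCone.mem_dual]
  intro f hf
  have key : ∀ ε : ℝ, 0 < ε → 0 ≤ f u + ε * f (chamberPoint δ) := by
    intro ε hε
    have hmem : u + ε • chamberPoint δ ∈ {v | PermEquivalent (chamberPoint δ) v} := by
      apply permEquivalent_chamberPoint
      intro a b hab
      have h1 : u (δ b) ≤ u (δ a) := hu hab.le
      have h2 : ((a : ℕ) : ℝ) < ((b : ℕ) : ℝ) := by exact_mod_cast hab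
      have h3 := mul_lt_mul_of_pos_left h2 hε
      simp only [chamberPoint, Pi.add_apply, Pi.smul_apply, smul_eq_mul,
        Equiv.symm_apply_apply]
      linarith
    have h := hsub hmem
    change u + ε • chamberPoint δ ∈ PointedCone.dual _ _ at h
    rw [PointedCone.mem_dual] at h
    simpa using h hf
  change 0 ≤ f u
  by_contra hneg
  push Not at hneg
  have h1 := key 1 one_pos
  have hp : 0 < f (chamberPoint δ) := by linarith
  have h2 := key (-f u / (2 * f (chamberPoint δ))) (by apply div_pos <;> linarith)
  have h3 : -f u / (2 * f (chamberPoint δ)) * f (chamberPoint δ) = -f u / 2 := by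
    field_simp
  rw [h3] at h2
  linarith

/-- A maximal cone of the `S_n`-fan lies in only one cone of a fan. -/
theorem IsFan.le_of_weylChamber_subset {n : ℕ} {F : Set (PointedCone ℝ (Fin n → ℝ))}
    (hF : IsFan F) {δ : Equiv.Perm (Fin n)} {C D : PointedCone ℝ (Fin n → ℝ)}
    (hC : C ∈ F) (hD : D ∈ F) (hδC : weylChamber δ ⊆ (C : Set (Fin n → ℝ)))
    (hδD : weylChamber δ ⊆ (D : Set (Fin n → ℝ))) : C ≤ D := by
  intro x hx
  have hface := hF.inter_face C hC D hD
  obtain ⟨R, hR0, hR⟩ : ∃ R : ℝ, 0 < R ∧ ∀ i, |x i| ≤ R :=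
    ⟨∑ i, |x i| + 1, by positivity, fun i => by
      have := Finset.single_le_sum (f := fun i => |x i|) (fun i _ => abs_nonneg _)
        (Finset.mem_univ i)
      linarith⟩
  -- the point `2 R p` of the chamber is `x + (2 R p - x)`, and the second summand is in the chamber
  have hp : (2 * R) • chamberPoint δ ∈ weylChamber δ := by
    intro a b hab
    have h2 : ((a : ℕ) : ℝ) ≤ ((b : ℕ) : ℝ) := by exact_mod_cast hab
    simp only [chamberPoint, Pi.smul_apply, smul_eq_mul, Equiv.symm_apply_apply]
    nlinarith
  have hq : (2 * R) • chamberPoint δ - x ∈ weylChamber δ := by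
    intro a b hab
    rcases hab.eq_or_lt with rfl | hlt
    · exact le_rfl
    have h2 : ((a : ℕ) : ℝ) + 1 ≤ ((b : ℕ) : ℝ) := by exact_mod_cast hlt
    have ha := abs_le.1 (hR (δ a))
    have hb := abs_le.1 (hR (δ b))
    simp only [chamberPoint, Pi.smul_apply, Pi.sub_apply, smul_eq_mul, Equiv.symm_apply_apply]
    nlinarith
  have hsum : x + ((2 * R) • chamberPoint δ - x) ∈ C ⊓ D := by
    rw [add_sub_cancel]
    exact ⟨hδC hp, hδD hp⟩
  exact (hface.mem_of_add_mem_left hx (hδC hq) hsum).2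

/-! ### Convex rank tests -/

/-- The partition of `S_n` induced by a coarsening `F` of the `S_n`-fan: two permutations are in the
same class if their maximal cones are contained in the same cone of `F`. -/
def inducedPartition {n : ℕ} (F : Set (PointedCone ℝ (Fin n → ℝ))) (hF : IsCoarsening F) :
    Setoid (Equiv.Perm (Fin n)) where
  r δ δ' := ∃ C ∈ F, weylChamber δ ⊆ (C : Set (Fin n → ℝ)) ∧
    weylChamber δ' ⊆ (C : Set (Fin n → ℝ))
  iseqv :=
    { refl := fun δ => by
        obtain ⟨C, hC, h⟩ := hF.exists_weylChamber_subset δ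
        exact ⟨C, hC, h, h⟩
      symm := fun ⟨C, hC, h, h'⟩ => ⟨C, hC, h', h⟩
      trans := fun ⟨C, hC, h1, h2⟩ ⟨D, hD, h3, h4⟩ =>
        ⟨D, hD, h1.trans (hF.toIsFan.le_of_weylChamber_subset hC hD h2 h3), h4⟩ }

/-- A convex rank test: a partition of `S_n` induced by a coarsening of the `S_n`-fan. -/
def IsConvexRankTest {n : ℕ} (τ : Setoid (Equiv.Perm (Fin n))) : Prop :=
  ∃ (F : Set (PointedCone ℝ (Fin n → ℝ))) (hF : IsCoarsening F), inducedPartition F hF = τ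

/-! ### Elementary conditional independence statements and semigraphoids -/

/-- A formal statement `left ⊥ right | cond` about elements `left`, `right` and a subset `cond`. -/
@[ext]
structure CIStatement (n : ℕ) where
  left : Fin n
  right : Fin n
  cond : Finset (Fin n)

/-- The set `T_n` of elementary CI statements `i ⊥ j | K`, where `i ≠ j` and `K` contains neither
`i` nor `j`. -/
def elementaryCI (n : ℕ) : Set (CIStatement n) :=
  {s | s.left ≠ s.right ∧ s.left ∉ s.cond ∧ s.right ∉ s.cond}

/-- Semigraphoids, as sets of elementary CI statements. In the last two fields, the premises
together with `subset` force `i`, `j`, `l` to be distinct and not in `K`. -/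
structure IsSemigraphoid {n : ℕ} (M : Set (CIStatement n)) : Prop where
  subset : M ⊆ elementaryCI n
  symm : ∀ i j K, (⟨i, j, K⟩ : CIStatement n) ∈ M → (⟨j, i, K⟩ : CIStatement n) ∈ M
  sg_left : ∀ i j l K, (⟨i, j, insert l K⟩ : CIStatement n) ∈ M →
    (⟨i, l, K⟩ : CIStatement n) ∈ M → (⟨i, j, K⟩ : CIStatement n) ∈ M
  sg_right : ∀ i j l K, (⟨i, j, insert l K⟩ : CIStatement n) ∈ M →
    (⟨i, l, K⟩ : CIStatement n) ∈ M → (⟨i, l, insert j K⟩ : CIStatement n) ∈ M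

/-! ### Walls and their labels -/

/-- The maximal cones indexed by `δ` and `δ'` share a wall at the positions `k` and `l = k + 1`:
the descent vectors differ exactly by exchanging the entries at these two adjacent positions. -/
def ShareWall {n : ℕ} (δ δ' : Equiv.Perm (Fin n)) (k l : Fin n) : Prop :=
  (l : ℕ) = k + 1 ∧ δ k = δ' l ∧ δ l = δ' k ∧ ∀ i, i ≠ k → i ≠ l → δ i = δ' i

/-- The CI statement `δ_k ⊥ δ_l | {δ_m : m < k}` that labels such a wall. -/
def wallLabel {n : ℕ} (δ : Equiv.Perm (Fin n)) (k l : Fin n) : CIStatement n :=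
  ⟨δ k, δ l, (Finset.univ.filter (fun m => m < k)).image δ⟩

/-- The set of CI statements of a rank test `τ`: the labels of the removed walls, which are the
walls whose two adjacent chambers belong to the same class. (The wall is an unordered pair: reading
it from `δ` or from `δ'` gives its label in the forms `i ⊥ j | K` and `j ⊥ i | K`, and both forms
are included.) -/
def ciStatements {n : ℕ} (τ : Setoid (Equiv.Perm (Fin n))) : Set (CIStatement n) :=
  {s | ∃ (δ δ' : Equiv.Perm (Fin n)) (k l : Fin n),
    ShareWall δ δ' k l ∧ τ δ δ' ∧ s = wallLabel δ k l}

/-! Two walls of a chamber generate a square of commuting exchanges or a hexagon, in which three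
consecutive entries are permuted. The semigraphoid axiom is a condition on the labels of each
hexagon.

From fans to semigraphoids: if `x` and `y` lie in a cone `C` of a fan and `x + y` lies in another
cone `D`, then `x` and `y` lie in `D`, because `C ⊓ D` is a face of `C`. `inducedPartition_of_add`
turns this into equivalences of chambers. Suitable `x` and `y` show that removal of a wall depends
only on its label (`inducedPartition_swap`) and give the hexagon axiom (`ciStatements_exchange`).
Equivalent chambers are joined by galleries of removed walls (`inducedPartition_swap_of_lt`), so the
labels determine the partition (`inducedPartition_le`).

From semigraphoids to fans: remove the walls with labels in `M`. Completing squares and hexagons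
shows that a class contains all shortest galleries between its members (`Reach.descent`). Hence it
consists of the linear extensions of a poset (`removeWalls_of_forall`), and its chambers fill a
polyhedral cone. The same completion carries equivalences across a wall (`removeWalls_swap_swap`),
which makes these cones meet in faces (`classCone_inf_isFaceOf`). Convexity of the classes also
shows that no wall outside `M` is removed (`ciStatements_removeWalls`). -/

namespace RankTest
open Equiv

variable {n : ℕ}

/-! ### Positions, adjacent entries and crossing a wall -/

/-- The position of `i` in the descent vector of `δ`. -/
def pos (δ : Perm (Fin n)) (i : Fin n) : ℕ := δ.symm i

/-- `j` comes immediately after `i` in the descent vector of `δ`. -/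
def Adj (δ : Perm (Fin n)) (i j : Fin n) : Prop := pos δ j = pos δ i + 1

/-- The entries of the descent vector of `δ` that come before `i`. -/
def predecessors (δ : Perm (Fin n)) (i : Fin n) : Finset (Fin n) :=
  Finset.univ.filter fun m => pos δ m < pos δ i

theorem pos_injective (δ : Perm (Fin n)) : Function.Injective (pos δ) :=
  fun _ _ h => δ.symm.injective (Fin.ext h)

theorem pos_inj {δ : Perm (Fin n)} {i j : Fin n} : pos δ i = pos δ j ↔ i = j :=
  (pos_injective δ).eq_iff

@[simp] theorem pos_apply (δ : Perm (Fin n)) (k : Fin n) : pos δ (δ k) = k := by simp [pos]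

theorem pos_swap_mul (δ : Perm (Fin n)) (i j m : Fin n) :
    pos (swap i j * δ) m = pos δ (swap i j m) := by
  simp [pos, Perm.mul_def]

@[simp] theorem pos_swap_left (δ : Perm (Fin n)) (i j : Fin n) :
    pos (swap i j * δ) i = pos δ j := by
  simp [pos_swap_mul]

@[simp] theorem pos_swap_right (δ : Perm (Fin n)) (i j : Fin n) :
    pos (swap i j * δ) j = pos δ i := by
  simp [pos_swap_mul]

theorem pos_swap_of_ne (δ : Perm (Fin n)) {i j m : Fin n} (hi : m ≠ i) (hj : m ≠ j) :
    pos (swap i j * δ) m = pos δ m := by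
  rw [pos_swap_mul, swap_apply_of_ne_of_ne hi hj]

theorem mem_predecessors {δ : Perm (Fin n)} {i m : Fin n} : m ∈ predecessors δ i ↔ pos δ m < pos δ i := by
  simp [predecessors]

namespace Adj

variable {x : Perm (Fin n)} {h i j k p q m : Fin n}

theorem lt (hx : Adj x i j) : pos x i < pos x j := by
  unfold Adj at hx; omega

theorem ne (hx : Adj x i j) : i ≠ j := by
  rintro rfl; exact lt_irrefl _ hx.lt

theorem right_unique (hx : Adj x i j) (hx' : Adj x i k) : j = k :=
  pos_injective x (by unfold Adj at hx hx'; omega)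

theorem left_unique (hx : Adj x i k) (hx' : Adj x j k) : i = j :=
  pos_injective x (by unfold Adj at hx hx'; omega)

theorem lt_of_ne (hx : Adj x i j) (hm : pos x i < pos x m) (hne : m ≠ j) :
    pos x j < pos x m := by
  have := mt (pos_inj (δ := x)).1 hne
  unfold Adj at hx; omega

theorem lt_of_ne' (hx : Adj x i j) (hm : pos x m < pos x j) (hne : m ≠ i) :
    pos x m < pos x i := by
  have := mt (pos_inj (δ := x)).1 hne
  unfold Adj at hx; omega

theorem ne_of_adj (hx : Adj x i j) (hx' : Adj x j k) : i ≠ k := by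
  rintro rfl
  exact lt_asymm hx.lt hx'.lt

theorem swap (hx : Adj x i j) : Adj (swap i j * x) j i := by
  unfold Adj at *; simpa using hx

theorem swap_right (hx : Adj x i j) (hx' : Adj x j k) : Adj (Equiv.swap i j * x) i k := by
  have h1 := (hx.ne_of_adj hx').symm
  have h2 := hx'.ne.symm
  unfold Adj at *
  rw [pos_swap_of_ne x h1 h2, pos_swap_left, hx']

theorem swap_left (hx : Adj x i j) (hx' : Adj x h i) : Adj (Equiv.swap i j * x) h j := by
  have h1 := hx'.ne_of_adj hx
  have h2 := hx'.ne
  unfold Adj at *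
  rw [pos_swap_of_ne x h2 h1, pos_swap_right, hx']

theorem swap_of_ne (hx : Adj x p q) (h1 : p ≠ i) (h2 : p ≠ j) (h3 : q ≠ i) (h4 : q ≠ j) :
    Adj (Equiv.swap i j * x) p q := by
  unfold Adj at *
  rwa [pos_swap_of_ne x h1 h2, pos_swap_of_ne x h3 h4]

/-- Crossing the wall between `i` and `j` changes the order of no other pair. -/
theorem swap_lt_swap_iff (hx : Adj x i j) {a b : Fin n} :
    pos (Equiv.swap i j * x) a < pos (Equiv.swap i j * x) b ↔
      (a = j ∧ b = i) ∨ (pos x a < pos x b ∧ ¬(a = i ∧ b = j)) := by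
  have hij := hx.ne
  -- Positions determine entries, so each case becomes linear arithmetic.
  have e : ∀ c d : Fin n, c = d ↔ pos x c = pos x d := fun c d => pos_inj.symm
  unfold Adj at hx
  rw [pos_swap_mul, pos_swap_mul, swap_apply_def, swap_apply_def]
  split_ifs <;> simp only [e] at * <;> omega

theorem predecessors_right (hx : Adj x i j) : predecessors x j = insert i (predecessors x i) := by
  ext m
  have := pos_inj (δ := x) (i := m) (j := i)
  unfold Adj at hx
  rw [Finset.mem_insert, mem_predecessors, mem_predecessors, ← this]
  omega

theorem predecessors_swap_right (hx : Adj x i j) : predecessors (Equiv.swap i j * x) j = predecessors x i := by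
  ext m
  rw [mem_predecessors, mem_predecessors, hx.swap_lt_swap_iff]
  constructor
  · rintro (h | ⟨h1, h2⟩)
    · exact absurd h.2.symm hx.ne
    · exact hx.lt_of_ne' h1 (by simpa using h2)
  · intro h
    exact Or.inr ⟨h.trans hx.lt, fun e => h.ne (congrArg _ e.1)⟩

theorem predecessors_swap_left (hx : Adj x i j) :
    predecessors (Equiv.swap i j * x) i = insert j (predecessors x i) := by
  rw [hx.swap.predecessors_right, hx.predecessors_swap_right]

theorem predecessors_swap_of_ne (hx : Adj x i j) (hi : m ≠ i) (hj : m ≠ j) :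
    predecessors (Equiv.swap i j * x) m = predecessors x m := by
  ext a
  rw [mem_predecessors, mem_predecessors, hx.swap_lt_swap_iff]
  tauto

end Adj

/-! ### Square and hexagon relations between exchanges -/

theorem swap_mul_swap_mul (i j : Fin n) (x : Perm (Fin n)) :
    swap j i * (swap i j * x) = x := by
  rw [swap_comm, swap_mul_self_mul]

theorem swap_mul_swap_comm {i j p q : Fin n} (h1 : i ≠ p) (h2 : i ≠ q) (h3 : j ≠ p) (h4 : j ≠ q)
    (x : Perm (Fin n)) : swap i j * (swap p q * x) = swap p q * (swap i j * x) := by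
  rw [← mul_assoc, ← mul_assoc]
  congr 1
  ext m
  simp only [Perm.mul_apply, swap_apply_def]
  split_ifs <;> simp_all

theorem swap_braid {a b c : Fin n} (h1 : a ≠ b) (h2 : a ≠ c) (h3 : b ≠ c) (x : Perm (Fin n)) :
    swap a b * (swap a c * (swap b c * x)) = swap b c * (swap a c * (swap a b * x)) := by
  simp only [← mul_assoc]
  congr 1
  ext m
  by_cases ha : m = a
  · subst ha
    rw [Perm.mul_apply, Perm.mul_apply, Perm.mul_apply, Perm.mul_apply,
      swap_apply_of_ne_of_ne h1 h2, swap_apply_left, swap_apply_of_ne_of_ne h2.symm h3.symm,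
      swap_apply_left, swap_apply_of_ne_of_ne h1.symm h3, swap_apply_left]
  by_cases hb : m = b
  · subst hb
    simp
  by_cases hc : m = c
  · subst hc
    rw [Perm.mul_apply, Perm.mul_apply, Perm.mul_apply, Perm.mul_apply,
      swap_apply_right, swap_apply_of_ne_of_ne h1.symm h3, swap_apply_right,
      swap_apply_of_ne_of_ne h2.symm h3.symm, swap_apply_right, swap_apply_of_ne_of_ne h1 h2]
  · simp [swap_apply_of_ne_of_ne, ha, hb, hc]

/-! ### Distance between chambers, and sorting a vector -/

/-- The number of pairs that are ordered oppositely in `b` and `x`. -/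
def inv (b x : Perm (Fin n)) : ℕ :=
  (Finset.univ.filter fun p : Fin n × Fin n =>
    pos b p.1 < pos b p.2 ∧ pos x p.2 < pos x p.1).card

/-- Only the exchanged pair changes its order, and it drops out of the count. This is the decreasing
measure for inductions along galleries. -/
theorem inv_swap_lt {b x : Perm (Fin n)} {i j : Fin n} (hx : Adj x i j)
    (hb : pos b j < pos b i) : inv b (swap i j * x) < inv b x := by
  apply Finset.card_lt_card
  rw [Finset.ssubset_iff_of_subset]
  · refine ⟨(j, i), by simpa using ⟨hb, hx.lt⟩, ?_⟩
    simp only [Finset.mem_filter, Finset.mem_univ, true_and, not_and, hx.swap_lt_swap_iff]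
    have := hx.ne
    tauto
  · rintro ⟨c, d⟩
    simp only [Finset.mem_filter, Finset.mem_univ, true_and, hx.swap_lt_swap_iff]
    rintro ⟨h1, ⟨rfl, rfl⟩ | h2⟩
    · exact absurd h1 hb.asymm
    · exact ⟨h1, h2.1⟩

/-- Two different permutations are separated by a wall of the second. -/
theorem exists_adj_lt {b x : Perm (Fin n)} (h : b ≠ x) :
    ∃ i j, Adj x i j ∧ pos b j < pos b i := by
  by_contra! hc
  apply h
  rcases n with _ | n
  · exact Subsingleton.elim _ _
  -- If no wall of `x` separates it from `b`, then `b⁻¹ * x` increases at each step, which forces it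
  -- to be the identity.
  have hmono : StrictMono (fun k => (b⁻¹ * x) k) := by
    rw [Fin.strictMono_iff_lt_succ]
    intro k
    have hadj : Adj x (x k.castSucc) (x k.succ) := by simp [Adj]
    have h1 := hc _ _ hadj
    have h2 := mt (pos_inj (δ := b)).1 hadj.ne
    exact lt_of_le_of_ne h1 (fun e => h2 (congrArg Fin.val e))
  have := (Perm.monotone_iff _).1 hmono.monotone
  exact (inv_mul_eq_one.1 this)

/-- Induction over a gallery from `b` to `x` that crosses each separating wall once. -/
theorem descent_induction {b : Perm (Fin n)} {P : Perm (Fin n) → Prop} (base : P b)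
    (step : ∀ x, (∀ y, inv b y < inv b x → P y) → ∀ i j, Adj x i j → pos b j < pos b i → P x)
    (x : Perm (Fin n)) : P x := by
  induction h : inv b x using Nat.strong_induction_on generalizing x with
  | _ N ih =>
    subst h
    by_cases hb : b = x
    · exact hb ▸ base
    · obtain ⟨i, j, hx, hlt⟩ := exists_adj_lt hb
      exact step x (fun y hy => ih _ hy y rfl) i j hx hlt

/-- The chamber containing `u` that is closest to `b`. -/
theorem exists_sorted (u : Fin n → ℝ) (b : Perm (Fin n)) :
    ∃ a : Perm (Fin n), ∀ i j, pos a i < pos a j ↔ u j < u i ∨ (u i = u j ∧ pos b i < pos b j) := by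
  -- The dual order sorts `u` decreasingly; the position in `b` breaks ties and makes the key
  -- injective.
  let f : Fin n → ℝᵒᵈ ×ₗ ℕ := fun i => toLex (OrderDual.toDual (u i), pos b i)
  have hf : Function.Injective f := by
    intro i j h
    have := congrArg (fun z => (ofLex z).2) h
    exact pos_injective b this
  refine ⟨Tuple.sort f, fun i j => ?_⟩
  have hm : StrictMono (f ∘ Tuple.sort f) :=
    (Tuple.monotone_sort f).strictMono_of_injective (hf.comp (Tuple.sort f).injective)
  have h1 := hm.lt_iff_lt (a := (Tuple.sort f).symm i) (b := (Tuple.sort f).symm j)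
  simp only [Function.comp, apply_symm_apply] at h1
  change (Tuple.sort f).symm i < (Tuple.sort f).symm j ↔ _
  rw [← h1, Prod.Lex.lt_iff]
  simp [f]

theorem adj_iff {x : Perm (Fin n)} {i j : Fin n} :
    Adj x i j ↔ pos x i < pos x j ∧ ∀ m, ¬(pos x i < pos x m ∧ pos x m < pos x j) := by
  constructor
  · intro h
    refine ⟨h.lt, fun m => ?_⟩
    unfold Adj at h
    omega
  · rintro ⟨h1, h2⟩
    by_contra h
    have hlt : pos x i + 1 < pos x j := by unfold Adj at h; omega
    have hn : pos x i + 1 < n := hlt.trans (x.symm j).isLt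
    have := h2 (x ⟨pos x i + 1, hn⟩)
    rw [pos_apply] at this
    simp only [not_and] at this
    exact this (by omega) hlt

/-! ### Removing the walls of a semigraphoid: convexity of the classes -/

variable {M : Set (CIStatement n)}

/-- `Step M x y`: the chambers `x` and `y` share a wall whose label is in `M`. -/
inductive Step (M : Set (CIStatement n)) : Perm (Fin n) → Perm (Fin n) → Prop
  | cross {x : Perm (Fin n)} {i j : Fin n} (hx : Adj x i j)
      (hm : (⟨i, j, predecessors x i⟩ : CIStatement n) ∈ M) : Step M x (swap i j * x)

/-- The partition of `S_n` obtained by removing the walls with labels in `M`. -/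
def removeWalls (M : Set (CIStatement n)) : Setoid (Perm (Fin n)) :=
  Relation.EqvGen.setoid (Step M)

theorem removeWalls_swap {x : Perm (Fin n)} {i j : Fin n} (hx : Adj x i j)
    (hm : (⟨i, j, predecessors x i⟩ : CIStatement n) ∈ M) : removeWalls M x (swap i j * x) :=
  Relation.EqvGen.rel _ _ (Step.cross hx hm)

/-- `Reach M b x`: there is a gallery from `b` to `x` that crosses only walls with labels in `M`
and crosses no hyperplane twice. -/
inductive Reach (M : Set (CIStatement n)) (b : Perm (Fin n)) : Perm (Fin n) → Prop
  | refl : Reach M b b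
  | step {x : Perm (Fin n)} {i j : Fin n} (h : Reach M b x) (hx : Adj x i j)
      (hb : pos b i < pos b j) (hm : (⟨i, j, predecessors x i⟩ : CIStatement n) ∈ M) :
      Reach M b (swap i j * x)

/-- Every wall of `x` that separates it from `b` has its label in `M`. -/
theorem Reach.descent (hM : IsSemigraphoid M) {b x : Perm (Fin n)} {i j : Fin n}
    (h : Reach M b x) (hx : Adj x i j) (hb : pos b j < pos b i) :
    (⟨i, j, predecessors x i⟩ : CIStatement n) ∈ M ∧ Reach M b (swap i j * x) := by
  induction hN : inv b x using Nat.strong_induction_on generalizing x i j with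
  | _ N ih =>
  subst hN
  cases h with
  | refl => exact absurd hb hx.lt.asymm
  | @step z p q hz hzpq hbpq hm =>
    have hxqp := hzpq.swap
    have hlt : inv b z < inv b (swap p q * z) := by
      have := inv_swap_lt hxqp hbpq
      rwa [swap_mul_swap_mul] at this
    by_cases hiq : i = q
    · subst hiq
      obtain rfl := hx.right_unique hxqp
      rw [swap_mul_swap_mul, hzpq.predecessors_swap_right]
      exact ⟨hM.symm _ _ _ hm, hz⟩
    -- Hexagon: `z` reads `i q j`, `x` reads `q i j`, and `b` has the order `j, i, q`. Induction
    -- leads from `z` down to `i j q` and `j i q`; the axiom supplies the other labels, so the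
    -- opposite side can be climbed through `j q i` to `q j i`.
    by_cases hip : i = p
    · subst hip
      have hqj : Adj z q j := by
        have := hxqp.swap_right hx
        rwa [swap_mul_swap_mul] at this
      have hiq' := hzpq.ne
      have hij := hx.ne
      have hqj' := hqj.ne
      obtain ⟨m1, r1⟩ := ih _ hlt hz hqj (hb.trans hbpq) rfl
      have lt1 := (inv_swap_lt hqj (hb.trans hbpq)).trans hlt
      have a1 : Adj (swap q j * z) i j := hqj.swap_left hzpq
      obtain ⟨m2, r2⟩ := ih _ lt1 r1 a1 hb rfl
      rw [hzpq.predecessors_right] at m1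
      rw [hqj.predecessors_swap_of_ne hiq' hij] at m2
      have hA := hM.sg_left q j i (predecessors z i) m1 (hM.symm _ _ _ hm)
      have hB := hM.sg_right q j i (predecessors z i) m1 (hM.symm _ _ _ hm)
      have hC := hM.sg_right i q j (predecessors z i) (hM.symm _ _ _ hB) m2
      have hD := hqj.swap
      have a2 : Adj (swap i j * (swap q j * z)) i q := a1.swap_right hD
      have b2 : predecessors (swap i j * (swap q j * z)) i = insert j (predecessors z i) := by
        rw [a1.predecessors_swap_left, hqj.predecessors_swap_of_ne hiq' hij]
      have r3 := r2.step a2 hbpq (b2 ▸ hM.symm _ _ _ hB)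
      have a3 := a2.swap_left a1.swap
      have b3 : predecessors (swap i q * (swap i j * (swap q j * z))) j = predecessors z i := by
        rw [a2.predecessors_swap_of_ne hij.symm hqj'.symm, a1.predecessors_swap_right,
          hqj.predecessors_swap_of_ne hiq' hij]
      have r4 := r3.step a3 (hb.trans hbpq) (b3 ▸ hM.symm _ _ _ hA)
      refine ⟨?_, ?_⟩
      · rw [hzpq.predecessors_swap_left]
        exact hC
      · rw [← swap_braid hij hiq' hqj'.symm, swap_mul_swap_mul] at r4
        exact r4
    -- The mirror hexagon: `z` reads `i p j`, `x` reads `i j p`, and `b` has the order `p, j, i`.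
    by_cases hjq : j = q
    · subst hjq
      have hzip : Adj z i p := by
        have := hxqp.swap_left hx
        rwa [swap_mul_swap_mul] at this
      have hpj' := hzpq.ne
      have hij := hx.ne
      have hip' := hzip.ne
      obtain ⟨m1, r1⟩ := ih _ hlt hz hzip (hbpq.trans hb) rfl
      have lt1 := (inv_swap_lt hzip (hbpq.trans hb)).trans hlt
      have a1 : Adj (swap i p * z) i j := hzip.swap_right hzpq
      obtain ⟨m2, r2⟩ := ih _ lt1 r1 a1 hb rfl
      rw [hzip.predecessors_right] at hm
      rw [hzip.predecessors_swap_left] at m2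
      have hA := hM.sg_left i j p (predecessors z i) m2 m1
      have hB := hM.sg_right i j p (predecessors z i) m2 m1
      have hC := hM.sg_left p j i (predecessors z i) hm (hM.symm _ _ _ m1)
      have a2 : Adj (swap i j * (swap i p * z)) p j := a1.swap_left hzip.swap
      have b2 : predecessors (swap i j * (swap i p * z)) p = predecessors z i := by
        rw [a1.predecessors_swap_of_ne hip'.symm hpj', hzip.predecessors_swap_right]
      have r3 := r2.step a2 hbpq (b2 ▸ hC)
      have a3 := a2.swap_right a1.swap
      have b3 : predecessors (swap p j * (swap i j * (swap i p * z))) p = insert j (predecessors z i) := by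
        rw [a2.predecessors_swap_left, b2]
      have r4 := r3.step a3 (hbpq.trans hb) (b3 ▸ hM.symm _ _ _ hB)
      refine ⟨?_, ?_⟩
      · rw [hzpq.predecessors_swap_of_ne hip' hij]
        exact hA
      · rw [swap_braid hip'.symm hpj' hij, swap_mul_swap_mul] at r4
        exact r4
    -- The two exchanges involve four different entries, so they commute and close a square.
    · have hjp : j ≠ p := by
        rintro rfl
        exact hiq (hx.left_unique hxqp)
      have hzij : Adj z i j := by
        have := hx.swap_of_ne (i := q) (j := p) hiq hip hjq hjp
        rwa [swap_mul_swap_mul] at this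
      obtain ⟨m1, r1⟩ := ih _ hlt hz hzij hb rfl
      have b2 : predecessors (swap i j * z) p = predecessors z p :=
        hzij.predecessors_swap_of_ne (Ne.symm hip) hjp.symm
      have r2 := r1.step (hzpq.swap_of_ne (Ne.symm hip) hjp.symm (Ne.symm hiq) (Ne.symm hjq)) hbpq
        (b2 ▸ hm)
      rw [hzpq.predecessors_swap_of_ne hip hiq, swap_mul_swap_comm hip hiq hjp hjq]
      exact ⟨m1, r2⟩

/-- A step away from `b` extends the gallery; a step towards `b` is covered by `Reach.descent`. -/
theorem Reach.of_step (hM : IsSemigraphoid M) {b x y : Perm (Fin n)} (h : Reach M b x)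
    (hs : Step M x y) : Reach M b y := by
  obtain ⟨hx, hm⟩ := hs
  rename_i i j
  rcases lt_trichotomy (pos b i) (pos b j) with hlt | heq | hlt
  · exact h.step hx hlt hm
  · exact absurd (pos_inj.1 heq) hx.ne
  · exact (h.descent hM hx hlt).2

theorem Step.symm (hM : IsSemigraphoid M) {x y : Perm (Fin n)} (h : Step M x y) : Step M y x := by
  obtain ⟨hx, hm⟩ := h
  have := Step.cross hx.swap (hx.predecessors_swap_right ▸ hM.symm _ _ _ hm)
  rwa [swap_mul_swap_mul] at this

/-- Each class of `removeWalls M` is convex. -/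
theorem reach_of_removeWalls (hM : IsSemigraphoid M) {b x : Perm (Fin n)}
    (h : removeWalls M b x) : Reach M b x := by
  have key : ∀ x y, Relation.EqvGen (Step M) x y → ∀ b, Reach M b x ↔ Reach M b y := by
    intro x y hxy
    induction hxy with
    | rel x y h => exact fun b => ⟨fun hr => hr.of_step hM h, fun hr => hr.of_step hM (h.symm hM)⟩
    | refl x => exact fun b => Iff.rfl
    | symm x y _ ih => exact fun b => (ih b).symm
    | trans x y z _ _ ih1 ih2 => exact fun b => (ih1 b).trans (ih2 b)
  exact (key b x h b).1 Reach.refl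

theorem mem_of_removeWalls (hM : IsSemigraphoid M) {b x : Perm (Fin n)} {i j : Fin n}
    (h : removeWalls M b x) (hx : Adj x i j) (hb : pos b j < pos b i) :
    (⟨i, j, predecessors x i⟩ : CIStatement n) ∈ M :=
  ((reach_of_removeWalls hM h).descent hM hx hb).1

/-- Each class of `removeWalls M` consists of all linear extensions of a poset. -/
theorem removeWalls_of_forall (hM : IsSemigraphoid M) {b x : Perm (Fin n)}
    (h : ∀ i j, (∀ y, removeWalls M b y → pos y i < pos y j) → pos x i < pos x j) :
    removeWalls M b x := by
  suffices H : ∀ y, removeWalls M b y → removeWalls M b x from H b (Setoid.refl' _ _)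
  intro y
  refine descent_induction (b := x) (P := fun y => removeWalls M b y → removeWalls M b x)
    id (fun y ih i j hy hlt hby => ?_) y
  -- If all members put `i` before `j`, so would `x`. Hence some member `z` has them reversed, and
  -- convexity puts the label of this wall of `y` in `M`.
  have hne : ¬∀ z, removeWalls M b z → pos z i < pos z j := fun hc => hlt.asymm (h i j hc)
  push Not at hne
  obtain ⟨z, hbz, hz⟩ := hne
  have hz' : pos z j < pos z i := lt_of_le_of_ne hz (fun e => hy.ne (pos_inj.1 e).symm)
  have hm := mem_of_removeWalls hM (Setoid.trans' _ (Setoid.symm' _ hbz) hby) hy hz'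
  exact ih _ (inv_swap_lt hy hlt) (Setoid.trans' _ hby (removeWalls_swap hy hm))

/-- If `i` and `j` are adjacent in two members of a class, then exchanging them yields two members
of a class. -/
theorem removeWalls_swap_swap (hM : IsSemigraphoid M) {a b : Perm (Fin n)} {i j : Fin n}
    (hab : removeWalls M a b) (ha : Adj a i j) (hb : Adj b i j) :
    removeWalls M (swap i j * a) (swap i j * b) := by
  refine descent_induction (b := a) (P := fun b => removeWalls M a b → Adj b i j →
    removeWalls M (swap i j * a) (swap i j * b)) (fun _ _ => Setoid.refl' _ _) ?_ b hab hb
  intro b ih p q hpq hlt hab hb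
  have hm := mem_of_removeWalls hM hab hpq hlt
  have lt1 := inv_swap_lt hpq hlt
  have hr1 := Setoid.trans' _ hab (removeWalls_swap hpq hm)
  -- Here `b` reads `p i j`, while `a` has `p` after the adjacent entries `i` and `j`. So `p` can
  -- move right past both within the class, and the axiom lets it pass the exchanged block `j i`
  -- too.
  by_cases hqi : q = i
  · subst hqi
    have hpq' := hpq.ne
    have hpj := hpq.ne_of_adj hb
    have hqj := hb.ne
    have hlt2 := ha.lt_of_ne hlt hpj
    have a1 := hpq.swap_right hb
    have m1 := mem_of_removeWalls hM hr1 a1 hlt2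
    have lt2 := (inv_swap_lt a1 hlt2).trans lt1
    have hr2 := Setoid.trans' _ hr1 (removeWalls_swap a1 m1)
    have a2 : Adj (swap p j * (swap p q * b)) q j := a1.swap_left hpq.swap
    refine Setoid.trans' _ (ih _ lt2 hr2 a2) (Setoid.symm' _ ?_)
    rw [hpq.predecessors_swap_left] at m1
    have hA := hM.sg_left p j q _ m1 hm
    have hB := hM.sg_right p j q _ m1 hm
    have a3 := hb.swap_left hpq
    have b3 := hb.predecessors_swap_of_ne hpq' hpj
    have a4 := a3.swap_right hb.swap
    have b4 : predecessors (swap p j * (swap q j * b)) p = insert j (predecessors b p) := by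
      rw [a3.predecessors_swap_left, b3]
    refine Setoid.trans' _ (removeWalls_swap a3 (b3 ▸ hA)) ?_
    have h4 := removeWalls_swap a4 (b4 ▸ hB)
    rw [swap_comm q j, swap_comm p j, swap_comm p q, swap_braid hqj.symm hpj.symm hpq'.symm] at *
    exact h4
  -- The mirror case: `b` reads `i j q`, and `q` moves left past the block.
  by_cases hpj : p = j
  · subst hpj
    have hpq' := hpq.ne
    have hiq := hb.ne_of_adj hpq
    have hip := hb.ne
    have hlt2 := ha.lt_of_ne' hlt hiq.symm
    have a1 := hpq.swap_left hb
    have m1 := mem_of_removeWalls hM hr1 a1 hlt2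
    have lt2 := (inv_swap_lt a1 hlt2).trans lt1
    have hr2 := Setoid.trans' _ hr1 (removeWalls_swap a1 m1)
    have a2 : Adj (swap i q * (swap p q * b)) i p := a1.swap_right hpq.swap
    refine Setoid.trans' _ (ih _ lt2 hr2 a2) (Setoid.symm' _ ?_)
    rw [hb.predecessors_right] at hm
    rw [hpq.predecessors_swap_of_ne hip hiq] at m1
    have hA := hM.sg_left q p i _ (hM.symm _ _ _ hm) (hM.symm _ _ _ m1)
    have hB := hM.sg_right q p i _ (hM.symm _ _ _ hm) (hM.symm _ _ _ m1)
    have a3 := hb.swap_right hpq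
    have b3 := hb.predecessors_swap_left
    have a4 := a3.swap_left hb.swap
    have b4 : predecessors (swap i q * (swap i p * b)) p = predecessors b i := by
      rw [a3.predecessors_swap_of_ne hip.symm hpq', hb.predecessors_swap_right]
    refine Setoid.trans' _ (removeWalls_swap a3 (b3 ▸ hM.symm _ _ _ hB)) ?_
    have h4 := removeWalls_swap a4 (b4 ▸ hM.symm _ _ _ hA)
    rw [swap_braid hip hiq hpq']
    exact h4
  · have hpi : p ≠ i := by
      rintro rfl
      obtain rfl := hpq.right_unique hb
      exact hlt.asymm ha.lt
    have hqj : q ≠ j := by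
      rintro rfl
      exact hpi (hpq.left_unique hb)
    have h1 := ih _ lt1 hr1 (hb.swap_of_ne (Ne.symm hpi) (Ne.symm hqi) (Ne.symm hpj) hqj.symm)
    have b2 := hb.predecessors_swap_of_ne hpi hpj
    have h2 := removeWalls_swap (hpq.swap_of_ne hpi hpj hqi hqj) (b2 ▸ hm)
    rw [swap_mul_swap_comm hpi hpj hqi hqj] at h2
    exact Setoid.trans' _ h1 (Setoid.symm' _ h2)

/-! ### Cones defined by comparisons of coordinates -/

theorem mem_weylChamber {δ : Perm (Fin n)} {u : Fin n → ℝ} :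
    u ∈ weylChamber δ ↔ ∀ i j, pos δ i < pos δ j → u j ≤ u i := by
  constructor
  · intro h i j hij
    have := h (a := δ.symm i) (b := δ.symm j) (le_of_lt hij)
    simpa using this
  · intro h k l hkl
    rcases hkl.eq_or_lt with rfl | hlt
    · exact le_rfl
    · exact h _ _ (by simpa using hlt)

/-- The functional `u ↦ u i - u j`. -/
def coordSub (i j : Fin n) : Module.Dual ℝ (Fin n → ℝ) :=
  LinearMap.proj (R := ℝ) (φ := fun _ : Fin n => ℝ) i - LinearMap.proj j

@[simp] theorem coordSub_apply (i j : Fin n) (u : Fin n → ℝ) : coordSub i j u = u i - u j := rfl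

/-- The cone of vectors that satisfy `u i ≥ u j` for all pairs `(i, j)` in `P`. -/
noncomputable def pairCone (P : Finset (Fin n × Fin n)) : PointedCone ℝ (Fin n → ℝ) :=
  PointedCone.dual
    (LinearMap.id : Module.Dual ℝ (Fin n → ℝ) →ₗ[ℝ] Module.Dual ℝ (Fin n → ℝ))
    ((fun p : Fin n × Fin n => coordSub p.1 p.2) '' P)

theorem mem_pairCone {P : Finset (Fin n × Fin n)} {u : Fin n → ℝ} :
    u ∈ pairCone P ↔ ∀ p ∈ P, u p.2 ≤ u p.1 := by
  rw [pairCone, PointedCone.mem_dual]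
  constructor
  · intro h p hp
    have := h (Set.mem_image_of_mem _ (Finset.mem_coe.2 hp))
    simpa using this
  · rintro h f ⟨p, hp, rfl⟩
    simpa using h p hp

theorem isPolyhedralCone_pairCone (P : Finset (Fin n × Fin n)) :
    IsPolyhedralCone (pairCone P) :=
  PointedCone.DualFG.dual_of_finite _ (P.finite_toSet.image _)

/-- A face of `pairCone P` is obtained by turning some of the inequalities into equations. -/
theorem exists_eq_pairCone_of_isFaceOf {P : Finset (Fin n × Fin n)}
    {D : PointedCone ℝ (Fin n → ℝ)} (hD : D.IsFaceOf (pairCone P)) :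
    ∃ Q, D = pairCone Q := by
  classical
  let E := P.filter fun p => ∀ u ∈ D, u p.1 = u p.2
  have hex : ∀ p : Fin n × Fin n, ∃ w ∈ D, p ∈ P → p ∉ E → w p.2 < w p.1 := by
    intro p
    by_cases hp : p ∈ P ∧ p ∉ E
    · obtain ⟨hp, hpE⟩ := hp
      have : ∃ u ∈ D, u p.1 ≠ u p.2 := by
        simpa [E, hp] using hpE
      obtain ⟨u, hu, hne⟩ := this
      exact ⟨u, hu, fun _ _ => lt_of_le_of_ne (mem_pairCone.1 (hD.le hu) p hp) hne.symm⟩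
    · exact ⟨0, D.zero_mem, fun h1 h2 => absurd ⟨h1, h2⟩ hp⟩
  choose w hwD hw using hex
  -- A relative interior point of `D`: it is strict in each inequality that is not an equation on
  -- all of `D`.
  let s := ∑ p, w p
  have hsD : s ∈ D := D.sum_mem fun p _ => hwD p
  have hs : ∀ p ∈ P, p ∉ E → s p.2 < s p.1 := by
    intro p hp hpE
    simp only [s, Finset.sum_apply]
    exact Finset.sum_lt_sum (fun q _ => mem_pairCone.1 (hD.le (hwD q)) p hp)
      ⟨p, Finset.mem_univ _, hw p hp hpE⟩
  refine ⟨P ∪ E.image Prod.swap, le_antisymm (fun u hu => ?_) (fun u hu => ?_)⟩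
  · rw [mem_pairCone]
    intro p hp
    rcases Finset.mem_union.1 hp with hp | hp
    · exact mem_pairCone.1 (hD.le hu) p hp
    · obtain ⟨q, hq, rfl⟩ := Finset.mem_image.1 hp
      exact ((Finset.mem_filter.1 hq).2 u hu).le
  · have huC : u ∈ pairCone P :=
      mem_pairCone.2 fun p hp => mem_pairCone.1 hu p (Finset.mem_union_left _ hp)
    have huE : ∀ p ∈ E, u p.1 ≤ u p.2 := fun p hp =>
      mem_pairCone.1 hu p.swap (Finset.mem_union_right _ (Finset.mem_image_of_mem _ hp))
    -- For such `N`, the point `N • s` of `D` is the sum of `u` and another vector of the cone, so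
    -- the face property yields `u ∈ D`.
    obtain ⟨N, hN0, hN⟩ : ∃ N : ℝ, 0 ≤ N ∧ ∀ p ∈ P, u p.1 - u p.2 ≤ N * (s p.1 - s p.2) := by
      have h0 : ∀ p ∈ P, 0 ≤ (u p.1 - u p.2) / (s p.1 - s p.2) := fun p hp =>
        div_nonneg (sub_nonneg.2 (mem_pairCone.1 huC p hp))
          (sub_nonneg.2 (mem_pairCone.1 (hD.le hsD) p hp))
      refine ⟨∑ p ∈ P, (u p.1 - u p.2) / (s p.1 - s p.2), Finset.sum_nonneg h0, fun p hp => ?_⟩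
      by_cases hpE : p ∈ E
      · have h1 := huE p hpE
        have h2 := (Finset.mem_filter.1 hpE).2 s hsD
        rw [h2]
        simpa using h1
      · have h1 := sub_pos.2 (hs p hp hpE)
        rw [← div_le_iff₀ h1]
        exact Finset.single_le_sum h0 hp
    have hsub : N • s - u ∈ pairCone P := by
      rw [mem_pairCone]
      intro p hp
      have := hN p hp
      simp only [Pi.sub_apply, Pi.smul_apply, smul_eq_mul]
      linarith
    refine hD.mem_of_add_mem_left huC hsub ?_
    rw [add_sub_cancel]
    exact D.smul_mem hN0 hsD

/-! ### The fan of a semigraphoid -/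

open Classical in
/-- The pairs that all members of the class of `b` order in the same way. -/
noncomputable def classPairs (M : Set (CIStatement n)) (b : Perm (Fin n)) : Finset (Fin n × Fin n) :=
  Finset.univ.filter fun p => ∀ y, removeWalls M b y → pos y p.1 < pos y p.2

/-- The union of the chambers in the class of `b`. -/
noncomputable def classCone (M : Set (CIStatement n)) (b : Perm (Fin n)) : PointedCone ℝ (Fin n → ℝ) :=
  pairCone (classPairs M b)

theorem mem_classCone {b : Perm (Fin n)} {u : Fin n → ℝ} :
    u ∈ classCone M b ↔
      ∀ i j, (∀ y, removeWalls M b y → pos y i < pos y j) → u j ≤ u i := by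
  simp [classCone, mem_pairCone, classPairs]

theorem weylChamber_subset_classCone {b y : Perm (Fin n)} (h : removeWalls M b y) :
    weylChamber y ⊆ (classCone M b : Set (Fin n → ℝ)) :=
  fun _ hu => mem_classCone.2 fun i j hij => mem_weylChamber.1 hu i j (hij y h)

theorem classCone_congr {b y : Perm (Fin n)} (h : removeWalls M b y) :
    classCone M b = classCone M y := by
  ext u
  rw [mem_classCone, mem_classCone]
  have : ∀ z, removeWalls M b z ↔ removeWalls M y z := fun z =>
    ⟨fun hz => Setoid.trans' _ (Setoid.symm' _ h) hz, fun hz => Setoid.trans' _ h hz⟩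
  simp only [this]

/-- Some chamber in the class of `b` contains `u`, and it orders the ties in `u` like `b`. -/
theorem exists_mem_weylChamber (hM : IsSemigraphoid M) {b : Perm (Fin n)} {u : Fin n → ℝ}
    (hu : u ∈ classCone M b) : ∃ a, removeWalls M b a ∧ u ∈ weylChamber a ∧
      ∀ i j, pos a i < pos a j ↔ u j < u i ∨ (u i = u j ∧ pos b i < pos b j) := by
  obtain ⟨a, ha⟩ := exists_sorted u b
  refine ⟨a, removeWalls_of_forall hM fun i j hij => ?_, mem_weylChamber.2 fun i j hij => ?_, ha⟩
  · rw [ha]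
    rcases (mem_classCone.1 hu i j hij).lt_or_eq with h | h
    · exact Or.inl h
    · exact Or.inr ⟨h.symm, hij b (Setoid.refl' _ _)⟩
  · rcases (ha i j).1 hij with h | h
    · exact h.le
    · exact h.1.ge

theorem mem_weylChamber_swap {a : Perm (Fin n)} {i j : Fin n} (ha : Adj a i j) {u : Fin n → ℝ}
    (hu : u ∈ weylChamber a) (huij : u i ≤ u j) : u ∈ weylChamber (swap i j * a) := by
  rw [mem_weylChamber] at *
  intro p q hpq
  rcases ha.swap_lt_swap_iff.1 hpq with ⟨rfl, rfl⟩ | h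
  · exact huij
  · exact hu p q h.1

/-- Take the chamber of the class that contains `x` and orders its ties like `c`. An entry between
`i` and `j` there would be tied with both and lie between them in `c`, so they are adjacent, and
`removeWalls_swap_swap` carries this chamber across the wall. -/
theorem mem_classCone_swap (hM : IsSemigraphoid M) {c : Perm (Fin n)} {i j : Fin n}
    (hc : Adj c i j) {x : Fin n → ℝ} (hx : x ∈ classCone M c) (hxij : x i = x j) :
    x ∈ classCone M (swap i j * c) := by
  obtain ⟨a, hca, hxa, ha⟩ := exists_mem_weylChamber hM hx
  have hadj : Adj a i j := by
    rw [adj_iff]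
    refine ⟨(ha i j).2 (Or.inr ⟨hxij, hc.lt⟩), ?_⟩
    rintro m ⟨h1, h2⟩
    rcases (ha i m).1 h1 with h3 | ⟨h3, h3'⟩ <;> rcases (ha m j).1 h2 with h4 | ⟨h4, h4'⟩
    · linarith
    · linarith
    · linarith
    · exact (adj_iff.1 hc).2 m ⟨h3', h4'⟩
  exact weylChamber_subset_classCone (removeWalls_swap_swap hM hca hc hadj)
    (mem_weylChamber_swap hadj hxa hxij.le)

/-- Crossing a wall that contains `x + y` keeps `x` and `y` in the cone of the class. -/
theorem mem_classCone_swap_of_add (hM : IsSemigraphoid M) {c : Perm (Fin n)} {i j : Fin n}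
    (hc : Adj c i j) {x y : Fin n → ℝ} (hx : x ∈ classCone M c) (hy : y ∈ classCone M c)
    (hxy : (x + y) i = (x + y) j) :
    x ∈ classCone M (swap i j * c) ∧ y ∈ classCone M (swap i j * c) := by
  by_cases hm : (⟨i, j, predecessors c i⟩ : CIStatement n) ∈ M
  · rw [← classCone_congr (removeWalls_swap hc hm)]
    exact ⟨hx, hy⟩
  -- A kept wall bounds the whole class, so `x` and `y` each satisfy its inequality; equality for
  -- the sum forces equality for both.
  · have hall : ∀ z, removeWalls M c z → pos z i < pos z j := by
      intro z hz
      by_contra hlt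
      have hlt' : pos z j < pos z i :=
        lt_of_le_of_ne (not_lt.1 hlt) fun e => hc.ne (pos_inj.1 e).symm
      exact hm (mem_of_removeWalls hM (Setoid.symm' _ hz) hc hlt')
    have h1 := mem_classCone.1 hx i j hall
    have h2 := mem_classCone.1 hy i j hall
    simp only [Pi.add_apply] at hxy
    exact ⟨mem_classCone_swap hM hc hx (by linarith), mem_classCone_swap hM hc hy (by linarith)⟩

/-- Walk from `c` to `c'` across separating walls. Chambers on both sides contain `x + y`, so every
such wall does, and `mem_classCone_swap_of_add` applies at each crossing. -/
theorem mem_classCone_of_add (hM : IsSemigraphoid M) {c c' : Perm (Fin n)} {x y : Fin n → ℝ}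
    (hc : x + y ∈ weylChamber c) (hc' : x + y ∈ weylChamber c')
    (hx : x ∈ classCone M c) (hy : y ∈ classCone M c) : x ∈ classCone M c' := by
  refine descent_induction (b := c') (P := fun c => x + y ∈ weylChamber c →
    x ∈ classCone M c → y ∈ classCone M c → x ∈ classCone M c') (fun _ h _ => h) ?_ c hc hx hy
  intro c ih i j hadj hlt hc hx hy
  have h1 := mem_weylChamber.1 hc i j hadj.lt
  have h2 := mem_weylChamber.1 hc' j i hlt
  obtain ⟨h3, h4⟩ := mem_classCone_swap_of_add hM hadj hx hy (h2.antisymm h1)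
  exact ih _ (inv_swap_lt hadj hlt) (mem_weylChamber_swap hadj hc h2) h3 h4

theorem classCone_inf_isFaceOf (hM : IsSemigraphoid M) (b b' : Perm (Fin n)) :
    (classCone M b ⊓ classCone M b').IsFaceOf (classCone M b) := by
  refine ⟨inf_le_left, fun {x y a} hx hy ha hxy => ⟨hx, ?_⟩⟩
  have hax : a • x ∈ classCone M b := (classCone M b).smul_mem ha.le hx
  obtain ⟨c, hbc, hc, -⟩ := exists_mem_weylChamber hM hxy.1
  obtain ⟨c', hbc', hc', -⟩ := exists_mem_weylChamber hM hxy.2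
  rw [classCone_congr hbc] at hax hy
  have := mem_classCone_of_add hM hc hc' hax hy
  rw [← classCone_congr hbc'] at this
  have h2 := (classCone M b').smul_mem (inv_pos.2 ha).le this
  rwa [smul_smul, inv_mul_cancel₀ ha.ne', one_smul] at h2

/-- The fan that consists of all faces of the cones `classCone M b`. -/
noncomputable def classFan (M : Set (CIStatement n)) : Set (PointedCone ℝ (Fin n → ℝ)) :=
  {D | ∃ b, D.IsFaceOf (classCone M b)}

theorem isFan_classFan (hM : IsSemigraphoid M) : IsFan (classFan M) where
  finite := by
    refine (Set.finite_range (pairCone (n := n))).subset ?_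
    rintro D ⟨b, hD⟩
    obtain ⟨Q, rfl⟩ := exists_eq_pairCone_of_isFaceOf hD
    exact ⟨Q, rfl⟩
  polyhedral := by
    rintro D ⟨b, hD⟩
    obtain ⟨Q, rfl⟩ := exists_eq_pairCone_of_isFaceOf hD
    exact isPolyhedralCone_pairCone Q
  face_mem := fun C ⟨b, hC⟩ D hD => ⟨b, hD.trans hC⟩
  inter_face := by
    rintro C ⟨b, hC⟩ D ⟨b', hD⟩
    refine ⟨inf_le_left, fun {x y a} hx hy ha hxy => ⟨hx, ?_⟩⟩
    have hb := hC.le hx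
    have hby := hC.le hy
    -- First split the sum in the maximal cones. Once both summands lie in `classCone M b'`, its
    -- face `D` splits it again.
    have h1 : a • x + y ∈ classCone M b ⊓ classCone M b' := ⟨hC.le hxy.1, hD.le hxy.2⟩
    have hface := classCone_inf_isFaceOf hM b b'
    have h2 := hface.mem_of_smul_add_mem hb hby ha h1
    have h3 := hface.mem_of_add_mem_right ((classCone M b).smul_mem ha.le hb) hby h1
    exact hD.mem_of_smul_add_mem h2.2 h3.2 ha hxy.2

theorem isCoarsening_classFan (hM : IsSemigraphoid M) : IsCoarsening (classFan M) where
  toIsFan := isFan_classFan hM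
  exists_cone := by
    intro u
    obtain ⟨a, ha⟩ := exists_sorted u 1
    refine ⟨classCone M a, ⟨a, .rfl⟩, fun v hv => ?_⟩
    refine weylChamber_subset_classCone (Setoid.refl' _ a) (mem_weylChamber.2 fun i j hij => ?_)
    rcases (ha i j).1 hij with h | h
    · exact ((hv j i).1.1 h).le
    · exact ((hv i j).2.1 h.1).ge

theorem chamberPoint_apply (δ : Perm (Fin n)) (i : Fin n) : chamberPoint δ i = -(pos δ i : ℝ) :=
  rfl

theorem chamberPoint_mem (δ : Perm (Fin n)) : chamberPoint δ ∈ weylChamber δ := by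
  rw [mem_weylChamber]
  intro i j hij
  rw [chamberPoint_apply, chamberPoint_apply, neg_le_neg_iff]
  exact_mod_cast hij.le

theorem eq_of_chamberPoint_mem {a δ : Perm (Fin n)} (h : chamberPoint δ ∈ weylChamber a) :
    a = δ := by
  by_contra hne
  obtain ⟨i, j, hij, hlt⟩ := exists_adj_lt hne
  have := mem_weylChamber.1 h j i hlt
  rw [chamberPoint_apply, chamberPoint_apply, neg_le_neg_iff] at this
  exact absurd hij.lt (not_lt.2 (by exact_mod_cast this))

/-- An interior point of a chamber lies in no other chamber, so a cone of this fan contains chambers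
of at most one class. -/
theorem inducedPartition_classFan (hM : IsSemigraphoid M) :
    inducedPartition (classFan M) (isCoarsening_classFan hM) = removeWalls M := by
  ext δ δ'
  constructor
  · rintro ⟨D, ⟨b, hD⟩, h, h'⟩
    have key : ∀ ε, weylChamber ε ⊆ (D : Set (Fin n → ℝ)) → removeWalls M b ε := by
      intro ε hε
      obtain ⟨a, hba, ha, -⟩ := exists_mem_weylChamber hM (hD.le (hε (chamberPoint_mem ε)))
      rwa [eq_of_chamberPoint_mem ha] at hba
    exact Setoid.trans' _ (Setoid.symm' _ (key δ h)) (key δ' h')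
  · intro h
    exact ⟨classCone M δ, ⟨δ, .rfl⟩, weylChamber_subset_classCone (Setoid.refl' _ _),
      weylChamber_subset_classCone h⟩

/-! ### CI statements as labels of walls -/

/-- Sort a vector with levels `K`, `i`, `j`, rest; the order within a level is irrelevant. Every
elementary CI statement thus labels a wall. -/
theorem exists_adj {i j : Fin n} {K : Finset (Fin n)} (hij : i ≠ j) (hi : i ∉ K) (hj : j ∉ K) :
    ∃ c : Perm (Fin n), Adj c i j ∧ predecessors c i = K := by
  let u : Fin n → ℝ := fun m => if m ∈ K then 3 else if m = i then 2 else if m = j then 1 else 0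
  have ui : u i = 2 := by simp [u, hi]
  have uj : u j = 1 := by simp [u, hj, hij.symm]
  obtain ⟨c, hc⟩ := exists_sorted u 1
  refine ⟨c, adj_iff.2 ⟨(hc i j).2 (Or.inl (by rw [ui, uj]; norm_num)), fun m => ?_⟩, ?_⟩
  · rw [hc, hc, ui, uj]
    by_cases h1 : m ∈ K
    · norm_num [u, h1]
    by_cases h2 : m = i
    · norm_num [u, h2, hi]
    by_cases h3 : m = j
    · norm_num [u, h3, hj, hij.symm]
    · norm_num [u, h1, h2, h3]
  · ext m
    rw [mem_predecessors, hc, ui]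
    by_cases h1 : m ∈ K
    · norm_num [u, h1]
    by_cases h2 : m = i
    · norm_num [u, h2, hi]
    by_cases h3 : m = j
    · norm_num [u, h3, hj, hij.symm]
    · norm_num [u, h1, h2, h3]

theorem exists_adj_adj {i j l : Fin n} {K : Finset (Fin n)} (hij : i ≠ j) (hil : i ≠ l)
    (hjl : j ≠ l) (hi : i ∉ K) (hj : j ∉ K) (hl : l ∉ K) :
    ∃ c : Perm (Fin n), Adj c i j ∧ Adj c j l ∧ predecessors c i = K := by
  let u : Fin n → ℝ := fun m =>
    if m ∈ K then 4 else if m = i then 3 else if m = j then 2 else if m = l then 1 else 0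
  have ui : u i = 3 := by simp [u, hi]
  have uj : u j = 2 := by simp [u, hj, hij.symm]
  have ul : u l = 1 := by simp [u, hl, hil.symm, hjl.symm]
  obtain ⟨c, hc⟩ := exists_sorted u 1
  have hcase : ∀ m, (m ∈ K ∧ u m = 4) ∨ m = i ∨ m = j ∨ m = l ∨ (m ∉ K ∧ u m = 0) := by
    intro m
    by_cases h1 : m ∈ K
    · simp [u, h1]
    by_cases h2 : m = i
    · simp [h2]
    by_cases h3 : m = j
    · simp [h3]
    by_cases h4 : m = l
    · simp [h4]
    · simp [u, h1, h2, h3, h4]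
  refine ⟨c, adj_iff.2 ⟨(hc i j).2 (Or.inl (by rw [ui, uj]; norm_num)), fun m => ?_⟩,
    adj_iff.2 ⟨(hc j l).2 (Or.inl (by rw [ul, uj]; norm_num)), fun m => ?_⟩, ?_⟩
  · rw [hc, hc, ui, uj]
    rcases hcase m with ⟨-, h⟩ | rfl | rfl | rfl | ⟨-, h⟩
    · norm_num [h]
    · norm_num [ui]
    · norm_num [uj]
    · norm_num [ul]
    · norm_num [h]
  · rw [hc, hc, ul, uj]
    rcases hcase m with ⟨-, h⟩ | rfl | rfl | rfl | ⟨-, h⟩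
    · norm_num [h]
    · norm_num [ui]
    · norm_num [uj]
    · norm_num [ul]
    · norm_num [h]
  · ext m
    rw [mem_predecessors, hc, ui]
    rcases hcase m with ⟨hm, h⟩ | rfl | rfl | rfl | ⟨hm, h⟩
    · norm_num [h, hm]
    · norm_num [ui, hi]
    · norm_num [uj, hj]
    · norm_num [ul, hl]
    · norm_num [h, hm]

theorem mem_ciStatements {τ : Setoid (Perm (Fin n))} {s : CIStatement n} :
    s ∈ ciStatements τ ↔ ∃ (δ : Perm (Fin n)) (i j : Fin n),
      Adj δ i j ∧ τ δ (swap i j * δ) ∧ s = ⟨i, j, predecessors δ i⟩ := by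
  constructor
  · rintro ⟨δ, δ', k, l, ⟨hl, h1, h2, h3⟩, hτ, rfl⟩
    have hδ' : δ' = swap (δ k) (δ l) * δ := by
      ext m
      by_cases hk : m = k
      · simp [hk, h2]
      by_cases hm : m = l
      · simp [hm, h1]
      · rw [Perm.mul_apply, swap_apply_of_ne_of_ne (by simpa using hk) (by simpa using hm),
          h3 m hk hm]
    refine ⟨δ, δ k, δ l, by simpa [Adj] using hl, hδ' ▸ hτ, ?_⟩
    simp only [wallLabel, CIStatement.mk.injEq, true_and]
    ext m
    obtain ⟨a, rfl⟩ := δ.surjective m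
    simp [mem_predecessors]
  · rintro ⟨δ, i, j, hadj, hτ, rfl⟩
    refine ⟨δ, swap i j * δ, δ.symm i, δ.symm j, ⟨hadj, ?_, ?_, ?_⟩, hτ, ?_⟩
    · simp
    · simp
    · intro m h1 h2
      rw [Perm.mul_apply, swap_apply_of_ne_of_ne]
      · rintro rfl; simp at h1
      · rintro rfl; simp at h2
    · simp only [wallLabel, apply_symm_apply, CIStatement.mk.injEq, true_and]
      ext m
      obtain ⟨a, rfl⟩ := δ.surjective m
      rw [mem_predecessors, pos_apply]
      simp [pos]

/-! ### When a cone of a coarsening contains a chamber -/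

theorem exists_nonneg_le_mul {ι : Type*} [Finite ι] (f g : ι → ℝ) :
    ∃ N : ℝ, 0 ≤ N ∧ ∀ p, 0 < g p → f p ≤ N * g p := by
  cases nonempty_fintype ι
  refine ⟨∑ p, |f p / g p|, Finset.sum_nonneg fun _ _ => abs_nonneg _, fun p hp => ?_⟩
  rw [← div_le_iff₀ hp]
  exact (le_abs_self _).trans
    (Finset.single_le_sum (f := fun p => |f p / g p|) (fun _ _ => abs_nonneg _)
      (Finset.mem_univ p))

variable {F : Set (PointedCone ℝ (Fin n → ℝ))}

/-- A cone of a coarsening that contains an interior point of a chamber contains the chamber. -/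
theorem weylChamber_subset_of_interior (hF : IsCoarsening F) {D : PointedCone ℝ (Fin n → ℝ)}
    (hD : D ∈ F) {δ : Perm (Fin n)} {u : Fin n → ℝ} (hu : u ∈ D)
    (hδ : ∀ i j, pos δ i < pos δ j → u j < u i) : weylChamber δ ⊆ (D : Set (Fin n → ℝ)) := by
  obtain ⟨E, hE, hδE⟩ := hF.exists_weylChamber_subset δ
  intro z hz
  obtain ⟨N, hN0, hN⟩ := exists_nonneg_le_mul (fun p : Fin n × Fin n => z p.1 - z p.2)
    (fun p => u p.1 - u p.2)
  have huE : u ∈ E := hδE (mem_weylChamber.2 fun i j hij => (hδ i j hij).le)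
  -- For large `N`, `N • u` is the sum of `z` and another vector of `E`; as it lies in the face `E ⊓
  -- D`, so does `z`.
  have hsub : N • u - z ∈ E := by
    refine hδE (mem_weylChamber.2 fun i j hij => ?_)
    have := hN (i, j) (sub_pos.2 (hδ i j hij))
    simp only [Pi.sub_apply, Pi.smul_apply, smul_eq_mul] at this ⊢
    linarith
  refine ((hF.inter_face E hE D hD).mem_of_add_mem_left (hδE hz) hsub ?_).2
  rw [add_sub_cancel]
  exact ⟨E.smul_mem hN0 huE, D.smul_mem hN0 hu⟩

/-- A cone of a coarsening contains a chamber as soon as it contains a point `y` of the chamber and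
a vector `v` that points from `y` into the interior of the chamber. -/
theorem weylChamber_subset_of_mem (hF : IsCoarsening F) {D : PointedCone ℝ (Fin n → ℝ)}
    (hD : D ∈ F) {δ : Perm (Fin n)} {v y : Fin n → ℝ} (hv : v ∈ D) (hy : y ∈ D)
    (hyδ : y ∈ weylChamber δ) (hδ : ∀ i j, pos δ i < pos δ j → y i = y j → v j < v i) :
    weylChamber δ ⊆ (D : Set (Fin n → ℝ)) := by
  -- In `N • y + v`, the multiple of `y` dominates where `y` is strict and `v` decides the ties of
  -- `y`; the `1` makes the inequalities strict.
  obtain ⟨N, hN0, hN⟩ := exists_nonneg_le_mul (fun p : Fin n × Fin n => v p.2 - v p.1 + 1)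
    (fun p => y p.1 - y p.2)
  refine weylChamber_subset_of_interior hF hD (D.add_mem (D.smul_mem hN0 hy) hv)
    (fun i j hij => ?_)
  simp only [Pi.add_apply, Pi.smul_apply, smul_eq_mul]
  rcases (mem_weylChamber.1 hyδ i j hij).eq_or_lt with h | h
  · have := hδ i j hij h.symm
    rw [h]
    linarith
  · have := hN (i, j) (sub_pos.2 h)
    simp only at this
    linarith

/-- Let a cone of a coarsening contain `x` and `y`, and let the chamber of `ε` contain `x + y`. Then
`ε` is equivalent to `ε'` if the chamber of `ε'` contains `y` and orders the ties in `y` like `ε`. -/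
theorem inducedPartition_of_add (hF : IsCoarsening F) {C : PointedCone ℝ (Fin n → ℝ)} (hC : C ∈ F)
    {x y : Fin n → ℝ} (hx : x ∈ C) (hy : y ∈ C) {ε ε' : Perm (Fin n)}
    (hε : x + y ∈ weylChamber ε) (hε' : y ∈ weylChamber ε')
    (h : ∀ i j, pos ε' i < pos ε' j → y i = y j → pos ε i < pos ε j) :
    inducedPartition F hF ε ε' := by
  obtain ⟨D, hD, hεD⟩ := hF.exists_weylChamber_subset ε
  have hyD : y ∈ D :=
    ((hF.inter_face C hC D hD).mem_of_add_mem_right hx hy ⟨C.add_mem hx hy, hεD hε⟩).2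
  refine ⟨D, hD, hεD, weylChamber_subset_of_mem hF hD (hεD (chamberPoint_mem ε)) hyD hε'
    fun i j hij e => ?_⟩
  rw [chamberPoint_apply, chamberPoint_apply, neg_lt_neg_iff]
  exact_mod_cast h i j hij e

/-- Serves test vectors that are `c` on an initial block and `0` on a final one: only `p` and `q`
need comparing. -/
theorem mem_weylChamber_of_levels {d : Perm (Fin n)} {p q : Fin n} (hd : Adj d p q) {c : ℝ}
    {v : Fin n → ℝ} (h : ∀ m, 0 ≤ v m ∧ v m ≤ c) (hK : ∀ m ∈ predecessors d p, v m = c)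
    (hrest : ∀ m, m ∉ predecessors d p → m ≠ p → m ≠ q → v m = 0) (hpq : v q ≤ v p) :
    v ∈ weylChamber d := by
  rw [mem_weylChamber]
  intro a b hab
  by_cases ha : a ∈ predecessors d p
  · rw [hK a ha]
    exact (h b).2
  rw [mem_predecessors] at ha
  by_cases hb : b = q
  · subst hb
    obtain rfl : a = p := by
      by_contra hne
      exact ha (hd.lt_of_ne' hab hne)
    exact hpq
  · rw [hrest b (by rw [mem_predecessors]; omega) (by rintro rfl; exact ha hab) hb]
    exact (h a).1

theorem mem_weylChamber_of_levels₃ {d : Perm (Fin n)} {p q r : Fin n} (hd : Adj d p q)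
    (hd' : Adj d q r) {c : ℝ} {v : Fin n → ℝ} (h : ∀ m, 0 ≤ v m ∧ v m ≤ c)
    (hK : ∀ m ∈ predecessors d p, v m = c)
    (hrest : ∀ m, m ∉ predecessors d p → m ≠ p → m ≠ q → m ≠ r → v m = 0) (hpq : v q ≤ v p)
    (hqr : v r ≤ v q) : v ∈ weylChamber d := by
  rw [mem_weylChamber]
  intro a b hab
  by_cases ha : a ∈ predecessors d p
  · rw [hK a ha]
    exact (h b).2
  rw [mem_predecessors] at ha
  have haq : ∀ a, pos d a < pos d q → ¬pos d a < pos d p → a = p := by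
    intro a h1 h2
    by_contra hne
    exact h2 (hd.lt_of_ne' h1 hne)
  by_cases hbq : b = q
  · subst hbq
    obtain rfl := haq a hab ha
    exact hpq
  by_cases hbr : b = r
  · subst hbr
    by_cases haq' : a = q
    · exact haq' ▸ hqr
    · obtain rfl := haq a (hd'.lt_of_ne' hab haq') ha
      exact hqr.trans hpq
  · rw [hrest b (by rw [mem_predecessors]; omega) (by rintro rfl; exact ha hab) hbq hbr]
    exact (h a).1

/-! ### The semigraphoid of a coarsening -/

/-- Walls with the same label are either all removed or all kept. -/
theorem inducedPartition_swap (hF : IsCoarsening F) {δ ε : Perm (Fin n)} {i j : Fin n}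
    (hδ : Adj δ i j) (hε : Adj ε i j) (hK : predecessors δ i = predecessors ε i)
    (h : inducedPartition F hF δ (swap i j * δ)) : inducedPartition F hF ε (swap i j * ε) := by
  obtain ⟨C, hC, h1, h2⟩ := h
  have hij := hδ.ne
  have hi : i ∉ predecessors ε i := by simp [mem_predecessors]
  have hj : j ∉ predecessors ε i := by simp [mem_predecessors, hε.lt.le]
  -- `w 3 1` lies in the chamber of `δ` and `w 1 3` in that of its neighbour. Their sum has levels
  -- `8, 4, 0` on `K`, `{i, j}` and the rest, so it also lies in the chamber of `ε`.
  let w : ℝ → ℝ → Fin n → ℝ := fun a b m =>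
    if m ∈ predecessors ε i then 4 else if m = i then a else if m = j then b else 0
  have wi : ∀ a b, w a b i = a := fun a b => by simp [w, hi]
  have wj : ∀ a b, w a b j = b := fun a b => by simp [w, hj, hij.symm]
  have wK : ∀ a b, ∀ m ∈ predecessors ε i, w a b m = 4 := fun a b m hm => by simp [w, hm]
  have w0 : ∀ a b m, m ∉ predecessors ε i → m ≠ i → m ≠ j → w a b m = 0 :=
    fun a b m h1 h2 h3 => by simp [w, h1, h2, h3]
  have hw : ∀ a b, 0 ≤ a → a ≤ 4 → 0 ≤ b → b ≤ 4 → ∀ m, 0 ≤ w a b m ∧ w a b m ≤ 4 := by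
    intro a b ha ha' hb hb' m
    simp only [w]
    split_ifs <;> constructor <;> linarith
  have hx : w 3 1 ∈ C := h1 (mem_weylChamber_of_levels hδ
    (hw 3 1 (by norm_num) (by norm_num) (by norm_num) (by norm_num)) (hK ▸ wK 3 1)
    (hK ▸ w0 3 1) (by rw [wi, wj]; norm_num))
  have hy' : ∀ d, Adj d i j → predecessors d i = predecessors ε i →
      w 1 3 ∈ weylChamber (swap i j * d) := by
    intro d hd hdK
    rw [← hd.predecessors_swap_right] at hdK
    exact mem_weylChamber_of_levels hd.swap
      (hw 1 3 (by norm_num) (by norm_num) (by norm_num) (by norm_num)) (hdK ▸ wK 1 3)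
      (fun m h1 h2 h3 => w0 1 3 m (hdK ▸ h1) h3 h2) (by rw [wi, wj]; norm_num)
  refine inducedPartition_of_add hF hC hx (h2 (hy' δ hδ hK)) (ε := ε) ?_ (hy' ε hε rfl) ?_
  · refine mem_weylChamber_of_levels hε (c := 8) (fun m => ?_) (fun m hm => ?_)
      (fun m h1 h2 h3 => ?_) ?_
    · have h1 := hw 3 1 (by norm_num) (by norm_num) (by norm_num) (by norm_num) m
      have h2 := hw 1 3 (by norm_num) (by norm_num) (by norm_num) (by norm_num) m
      simp only [Pi.add_apply]
      constructor <;> linarith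
    · simp only [Pi.add_apply, wK _ _ m hm]
      norm_num
    · simp only [Pi.add_apply, w0 _ _ m h1 h2 h3]
      norm_num
    · simp only [Pi.add_apply, wi, wj]
      norm_num
  · intro a b hab e
    rcases hε.swap_lt_swap_iff.1 hab with ⟨rfl, rfl⟩ | h
    · rw [wi, wj] at e
      norm_num at e
    · exact h.1

theorem mem_ciStatements_inducedPartition (hF : IsCoarsening F) {δ : Perm (Fin n)} {i j : Fin n}
    (hδ : Adj δ i j) :
    (⟨i, j, predecessors δ i⟩ : CIStatement n) ∈ ciStatements (inducedPartition F hF) ↔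
      inducedPartition F hF δ (swap i j * δ) := by
  rw [mem_ciStatements]
  constructor
  · rintro ⟨ε, i', j', hε, h, e⟩
    simp only [CIStatement.mk.injEq] at e
    obtain ⟨rfl, rfl, hK⟩ := e
    exact inducedPartition_swap hF hε hδ hK.symm h
  · exact fun h => ⟨δ, i, j, hδ, h, rfl⟩

theorem ciStatements_subset (τ : Setoid (Perm (Fin n))) : ciStatements τ ⊆ elementaryCI n := by
  intro s hs
  obtain ⟨δ, i, j, hδ, -, rfl⟩ := mem_ciStatements.1 hs
  exact ⟨hδ.ne, by simp [mem_predecessors], by simp [mem_predecessors, hδ.lt.le]⟩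

theorem ciStatements_symm (τ : Setoid (Perm (Fin n))) {i j : Fin n} {K : Finset (Fin n)}
    (h : (⟨i, j, K⟩ : CIStatement n) ∈ ciStatements τ) :
    (⟨j, i, K⟩ : CIStatement n) ∈ ciStatements τ := by
  obtain ⟨δ, i', j', hδ, hτ, e⟩ := mem_ciStatements.1 h
  simp only [CIStatement.mk.injEq] at e
  obtain ⟨rfl, rfl, rfl⟩ := e
  refine mem_ciStatements.2 ⟨swap i j * δ, j, i, hδ.swap, ?_, ?_⟩
  · rw [swap_mul_swap_mul]
    exact Setoid.symm' _ hτ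
  · rw [hδ.predecessors_swap_right]

theorem ciStatements_exchange (hF : IsCoarsening F) {i j l : Fin n} {K : Finset (Fin n)}
    (h1 : (⟨i, j, insert l K⟩ : CIStatement n) ∈ ciStatements (inducedPartition F hF))
    (h2 : (⟨i, l, K⟩ : CIStatement n) ∈ ciStatements (inducedPartition F hF)) :
    (⟨i, j, K⟩ : CIStatement n) ∈ ciStatements (inducedPartition F hF) ∧
      (⟨i, l, insert j K⟩ : CIStatement n) ∈ ciStatements (inducedPartition F hF) := by
  obtain ⟨hij, hi, hj⟩ := ciStatements_subset _ h1
  obtain ⟨hil, -, hl⟩ := ciStatements_subset _ h2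
  simp only [Finset.mem_insert, not_or] at hij hi hj hil hl
  have hjl := hj.1
  -- the six chambers around the codimension two cone are `e = ijl`, `f = jil`, `g = jli`,
  -- `h = lji`, `c = lij` and `d = ilj`
  obtain ⟨e, he1, he2, heK⟩ := exists_adj_adj hij hil hjl hi.2 hj.2 hl
  have hd1 := he2.swap_left he1
  have hd2 := he2.swap
  have hdK : predecessors (swap j l * e) i = K := by
    rw [he2.predecessors_swap_of_ne hij hil, heK]
  have hc2 := hd1.swap_right hd2
  have hcK : predecessors (swap i l * (swap j l * e)) i = insert l K := by
    rw [hd1.predecessors_swap_left, hdK]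
  have hf1 := he1.swap
  have hf2 := he1.swap_right he2
  have hfK : predecessors (swap i j * e) j = K := by
    rw [he1.predecessors_swap_right, heK]
  have hfK' : predecessors (swap i j * e) i = insert j K := by
    rw [he1.predecessors_swap_left, heK]
  have hg1 : Adj (swap i l * (swap i j * e)) j l := hf2.swap_left hf1
  have hg2 : Adj (swap i l * (swap i j * e)) l i := hf2.swap
  have hgK : predecessors (swap i l * (swap i j * e)) j = K := by
    rw [hf2.predecessors_swap_of_ne hij.symm hjl, hfK]
  rw [← hcK, mem_ciStatements_inducedPartition hF hc2] at h1
  rw [← hdK, mem_ciStatements_inducedPartition hF hd1] at h2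
  rw [swap_braid hij hil hjl] at h1
  obtain ⟨C, hC, hCd, hCh⟩ := Setoid.trans' _ h2 h1
  -- The premises put `d`, `c` and `h` in one cone `C`. It contains `w 3 1`, on the wall between `d`
  -- and `e`, and `w 1 3`, on the wall between `g` and `h`. In the sum `i`, `j` and `l` are tied, so
  -- it lies in all six chambers, and `inducedPartition_of_add` makes `e` and `f` equivalent to `g`.
  let w : ℝ → ℝ → Fin n → ℝ := fun a b m =>
    if m ∈ K then 4 else if m = i then a else if m = j then b else if m = l then b else 0
  have wi : ∀ a b, w a b i = a := fun a b => by simp [w, hi.2]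
  have wj : ∀ a b, w a b j = b := fun a b => by simp [w, hj.2, hij.symm]
  have wl : ∀ a b, w a b l = b := fun a b => by simp [w, hl, hil.symm]
  have wK : ∀ a b, ∀ m ∈ K, w a b m = 4 := fun a b m hm => by simp [w, hm]
  have w0 : ∀ a b m, m ∉ K → m ≠ i → m ≠ j → m ≠ l → w a b m = 0 :=
    fun a b m h1 h2 h3 h4 => by simp [w, h1, h2, h3, h4]
  have hw : ∀ a b, 0 ≤ a → a ≤ 4 → 0 ≤ b → b ≤ 4 → ∀ m, 0 ≤ w a b m ∧ w a b m ≤ 4 := by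
    intro a b ha ha' hb hb' m
    simp only [w]
    split_ifs <;> constructor <;> linarith
  have hx : w 3 1 ∈ C := by
    refine hCd (mem_weylChamber_swap he2 (mem_weylChamber_of_levels₃ he1 he2
      (hw 3 1 (by norm_num) (by norm_num) (by norm_num) (by norm_num)) (heK.symm ▸ wK 3 1)
      (heK.symm ▸ w0 3 1) ?_ ?_) ?_)
    · rw [wi, wj]; norm_num
    · rw [wj, wl]
    · rw [wj, wl]
  have hyg : w 1 3 ∈ weylChamber (swap i l * (swap i j * e)) := by
    refine mem_weylChamber_of_levels₃ hg1 hg2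
      (hw 1 3 (by norm_num) (by norm_num) (by norm_num) (by norm_num)) (hgK.symm ▸ wK 1 3)
      (fun m h1 h2 h3 h4 => w0 1 3 m (hgK ▸ h1) h4 h2 h3) ?_ ?_
    · rw [wj, wl]
    · rw [wi, wl]; norm_num
  have hy : w 1 3 ∈ C := hCh (mem_weylChamber_swap hg1 hyg (by rw [wj, wl]))
  have hse : w 3 1 + w 1 3 ∈ weylChamber e := by
    refine mem_weylChamber_of_levels₃ he1 he2 (c := 8) (fun m => ?_) (fun m hm => ?_)
      (fun m h1 h2 h3 h4 => ?_) ?_ ?_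
    · have h1 := hw 3 1 (by norm_num) (by norm_num) (by norm_num) (by norm_num) m
      have h2 := hw 1 3 (by norm_num) (by norm_num) (by norm_num) (by norm_num) m
      simp only [Pi.add_apply]
      constructor <;> linarith
    · simp only [Pi.add_apply, wK _ _ m (heK ▸ hm)]
      norm_num
    · simp only [Pi.add_apply, w0 _ _ m (heK ▸ h1) h2 h3 h4]
      norm_num
    · simp only [Pi.add_apply, wi, wj]
      norm_num
    · simp only [Pi.add_apply, wl, wj]
      norm_num
  have hsf : w 3 1 + w 1 3 ∈ weylChamber (swap i j * e) := by
    refine mem_weylChamber_swap he1 hse ?_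
    simp only [Pi.add_apply, wi, wj]
    norm_num
  have hfg : inducedPartition F hF (swap i j * e) (swap i l * (swap i j * e)) := by
    refine inducedPartition_of_add hF hC hx hy hsf hyg fun a b hab e => ?_
    rcases hf2.swap_lt_swap_iff.1 hab with ⟨rfl, rfl⟩ | h
    · rw [wi, wl] at e
      norm_num at e
    · exact h.1
  have heg : inducedPartition F hF e (swap i l * (swap i j * e)) := by
    refine inducedPartition_of_add hF hC hx hy hse hyg fun a b hab e => ?_
    rcases hf2.swap_lt_swap_iff.1 hab with ⟨rfl, rfl⟩ | h
    · rw [wi, wl] at e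
      norm_num at e
    · rcases he1.swap_lt_swap_iff.1 h.1 with ⟨rfl, rfl⟩ | h
      · rw [wi, wj] at e
        norm_num at e
      · exact h.1
  constructor
  · rw [← heK, mem_ciStatements_inducedPartition hF he1]
    exact Setoid.trans' _ heg (Setoid.symm' _ hfg)
  · rw [← hfK', mem_ciStatements_inducedPartition hF hf2]
    exact hfg

theorem isSemigraphoid_ciStatements (hF : IsCoarsening F) :
    IsSemigraphoid (ciStatements (inducedPartition F hF)) where
  subset := ciStatements_subset _
  symm := fun _ _ _ => ciStatements_symm _
  sg_left := fun _ _ _ _ h1 h2 => (ciStatements_exchange hF h1 h2).1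
  sg_right := fun _ _ _ _ h1 h2 => (ciStatements_exchange hF h1 h2).2

/-! ### Recovering each structure from the labels -/

/-- Every wall of `δ` that separates it from an equivalent chamber `δ'` is removed. -/
theorem inducedPartition_swap_of_lt (hF : IsCoarsening F) {δ δ' : Perm (Fin n)} {i j : Fin n}
    (h : inducedPartition F hF δ δ') (hδ : Adj δ i j) (hlt : pos δ' j < pos δ' i) :
    inducedPartition F hF δ (swap i j * δ) := by
  obtain ⟨D, hD, h1, h2⟩ := h
  -- This is `chamberPoint δ` with `j` raised to the level of `i`, a point of the wall with no other
  -- tie. From there `chamberPoint δ'` points into the neighbouring chamber.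
  let y : Fin n → ℝ := fun m => -((min (pos δ m) (if m = j then pos δ i else pos δ m) : ℕ) : ℝ)
  have hy : ∀ a b, pos δ a < pos δ b → y b ≤ y a ∧ (y a = y b → a = i ∧ b = j) := by
    intro a b hab
    have e : ∀ c d : Fin n, c = d ↔ pos δ c = pos δ d := fun c d => pos_inj.symm
    simp only [y, neg_le_neg_iff, neg_inj, Nat.cast_le, Nat.cast_inj]
    unfold Adj at hδ
    simp only [e]
    split_ifs <;> omega
  have hyδ : y ∈ weylChamber δ := mem_weylChamber.2 fun a b hab => (hy a b hab).1
  have hij : y i ≤ y j := by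
    simp [y, hδ.ne, hδ.lt.le]
  refine ⟨D, hD, h1, weylChamber_subset_of_mem hF hD (h2 (chamberPoint_mem δ')) (h1 hyδ)
    (mem_weylChamber_swap hδ hyδ hij) fun a b hab e => ?_⟩
  rcases hδ.swap_lt_swap_iff.1 hab with ⟨rfl, rfl⟩ | ⟨h, hne⟩
  · rw [chamberPoint_apply, chamberPoint_apply, neg_lt_neg_iff]
    exact_mod_cast hlt
  · exact absurd ((hy a b h).2 e) hne

/-- Walk from `δ` to `δ'` across walls removed by `F`. Their labels belong to `G` as well, and `G`
removes every wall with such a label. -/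
theorem inducedPartition_le {F G : Set (PointedCone ℝ (Fin n → ℝ))} (hF : IsCoarsening F)
    (hG : IsCoarsening G)
    (h : ciStatements (inducedPartition F hF) ⊆ ciStatements (inducedPartition G hG)) :
    inducedPartition F hF ≤ inducedPartition G hG := by
  intro δ δ'
  refine descent_induction (b := δ') (P := fun δ => inducedPartition F hF δ δ' →
    inducedPartition G hG δ δ') (fun _ => Setoid.refl' _ _) ?_ δ
  intro δ ih i j hδ hlt hτ
  have h1 := inducedPartition_swap_of_lt hF hτ hδ hlt
  have h2 := (mem_ciStatements_inducedPartition hG hδ).1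
    (h ((mem_ciStatements_inducedPartition hF hδ).2 h1))
  exact Setoid.trans' _ h2
    (ih _ (inv_swap_lt hδ hlt) (Setoid.trans' _ (Setoid.symm' _ h1) hτ))

/-- Generating an equivalence relation might remove further walls; convexity of the classes excludes
this. -/
theorem ciStatements_removeWalls {M : Set (CIStatement n)} (hM : IsSemigraphoid M) :
    ciStatements (removeWalls M) = M := by
  ext s
  rw [mem_ciStatements]
  constructor
  · rintro ⟨δ, i, j, hδ, hτ, rfl⟩
    refine mem_of_removeWalls hM (Setoid.symm' _ hτ) hδ ?_
    simpa using hδ.lt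
  · intro hs
    obtain ⟨i, j, K⟩ := s
    obtain ⟨h1, h2, h3⟩ := hM.subset hs
    obtain ⟨δ, hδ, hK⟩ := exists_adj h1 h2 h3
    simp only at hδ hK
    subst hK
    exact ⟨δ, i, j, hδ, removeWalls_swap hδ hs, rfl⟩

end RankTest

theorem theorem3p1 (n : ℕ) :
    Set.BijOn (ciStatements (n := n))
      {τ : Setoid (Equiv.Perm (Fin n)) | IsConvexRankTest τ}
      {M : Set (CIStatement n) | IsSemigraphoid M} := by
  refine ⟨?_, ?_, ?_⟩
  · rintro _ ⟨F, hF, rfl⟩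
    exact RankTest.isSemigraphoid_ciStatements hF
  · rintro _ ⟨F, hF, rfl⟩ _ ⟨G, hG, rfl⟩ h
    exact le_antisymm (RankTest.inducedPartition_le hF hG h.le)
      (RankTest.inducedPartition_le hG hF h.ge)
  · intro M hM
    exact ⟨RankTest.removeWalls M, ⟨_, _, RankTest.inducedPartition_classFan hM⟩,
      RankTest.ciStatements_removeWalls hM⟩
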